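/- Let $C\ge 1$. There exist constants $c>0$ and $C'>0$, depending only on $C$, such that the following holds for every finite field $\mathbf{F}_q$ (with $q$ elements) and all integers $n,m\ge 0$. Let $M=M_{n\times(n+m)}$ be a random $n\times(n+m)$ matrix over $\mathbf{F}_q$ whose entries $x_{ij}$ are independent, not necessarily identically distributed, and near uniform with constant $C$, that is, $$\mathbf{P}(x_{ij}=a)\le \frac{C}{q}\qquad\text{for all } a\in\mathbf{F}_q \text{ and all } i,j.$$ Let $Q(M)=n-\operatorname{rank}(M)$ be its corank, and let $Q_{m,\infty}$ be a random variable with values in $\{0,1,2,\dots\}$ and law $$\mathbf{P}(Q_{m,\infty}=k)=\frac{1}{q^{k(m+k)}}\,\frac{\prod_{i=k+1}^{\infty}(1-q^{-i})}{\prod_{i=1}^{m+k}(1-q^{-i})},\qquad k\ge 0 .$$ Then $$\|Q(M)-Q_{m,\infty}\|_{TV}\le\Big(\frac{C'}{q}\Big)^{c(m+n)},$$ where $\|Q-Q'\|_{TV}=\sup_{A}|\mathbf{P}(Q\in A)-\mathbf{P}(Q'\in A)|$, the supremum over all sets $A$ of nonnegative integers, is the total variation distance of the laws. -/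

import Mathlib

open MeasureTheory ProbabilityTheory

noncomputable section

namespace RandomCorank

/-- The corank `n - rank A` of an `n × k` matrix over a field. The rank is at most the number `n`
of rows, so the subtraction of natural numbers never truncates. -/
def corank {F : Type*} [Field F] {n k : ℕ} (A : Matrix (Fin n) (Fin k) F) : ℕ :=
  n - A.rank

/-- A random variable `ξ` with values in a finite field `F` with `q` elements is near uniform with
constant `C` if `P(ξ = a) ≤ C / q` for every `a ∈ F`. -/
def NearUniform {F Ω : Type*} [Fintype F] [MeasurableSpace Ω]
    (C : ℝ) (ξ : Ω → F) (P : Measure Ω) : Prop :=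
  ∀ a : F, P.real {ω | ξ ω = a} ≤ C / (Fintype.card F : ℝ)

/-- Total variation distance of two probability measures: `sup_A |μ(A) - ν(A)|` over all
measurable sets `A`. -/
def tvDist {α : Type*} [MeasurableSpace α] (μ ν : Measure α) : ℝ :=
  ⨆ A : {A : Set α // MeasurableSet A}, |μ.real A - ν.real A|

/-- The weight
`q^{-k(m+k)} ∏_{i ≥ k+1} (1 - q^{-i}) / ∏_{i=1}^{m+k} (1 - q^{-i})`
which the limit law gives to `k`. -/
def limitWeight (q m k : ℕ) : ℝ :=
  1 / (q : ℝ) ^ (k * (m + k)) *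
    ((∏' i : ℕ, (1 - 1 / (q : ℝ) ^ (k + 1 + i))) /
      ∏ i ∈ Finset.Icc 1 (m + k), (1 - 1 / (q : ℝ) ^ i))

/-! The weights are nonnegative and sum to one. -/

section Weights

variable {x : ℝ}

theorem summable_aux (h0 : 0 < x) (h1 : x < 1) (k : ℕ) :
    Summable fun i : ℕ => ‖-(x ^ (i + k))‖ := by
  simp only [norm_neg, norm_pow, Real.norm_eq_abs, abs_of_pos h0]
  exact (summable_nat_add_iff k).2 (summable_geometric_of_lt_one h0.le h1)

theorem multipliable_aux (h0 : 0 < x) (h1 : x < 1) (k : ℕ) :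
    Multipliable fun i : ℕ => 1 - x ^ (i + k) := by
  simpa [sub_eq_add_neg] using multipliable_one_add_of_summable (summable_aux h0 h1 k)

theorem factor_pos (h0 : 0 < x) (h1 : x < 1) (i : ℕ) : 0 < 1 - x ^ (i + 1) :=
  sub_pos.2 (pow_lt_one₀ h0.le h1 (Nat.succ_ne_zero i))

theorem prod_aux_pos (h0 : 0 < x) (h1 : x < 1) (j : ℕ) :
    0 < ∏ i ∈ Finset.range j, (1 - x ^ (i + 1)) :=
  Finset.prod_pos fun i _ => factor_pos h0 h1 i

theorem tendsto_prod_aux (h0 : 0 < x) (h1 : x < 1) :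
    Filter.Tendsto (fun j => ∏ i ∈ Finset.range j, (1 - x ^ (i + 1))) Filter.atTop
      (nhds (∏' i : ℕ, (1 - x ^ (i + 1)))) :=
  (multipliable_aux h0 h1 1).tendsto_prod_tprod_nat

theorem tprod_aux_pos (h0 : 0 < x) (h1 : x < 1) : 0 < ∏' i : ℕ, (1 - x ^ (i + 1)) := by
  have hne : ∏' i : ℕ, (1 + -(x ^ (i + 1))) ≠ 0 := by
    refine tprod_one_add_ne_zero_of_summable (fun i => ?_) (summable_aux h0 h1 1)
    have := factor_pos h0 h1 i
    linarith
  simp only [← sub_eq_add_neg] at hne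
  exact lt_of_le_of_ne
    (ge_of_tendsto' (tendsto_prod_aux h0 h1) fun j => (prod_aux_pos h0 h1 j).le) hne.symm

theorem tprod_le_prod (h0 : 0 < x) (h1 : x < 1) (j : ℕ) :
    ∏' i : ℕ, (1 - x ^ (i + 1)) ≤ ∏ i ∈ Finset.range j, (1 - x ^ (i + 1)) := by
  have hanti : Antitone fun j => ∏ i ∈ Finset.range j, (1 - x ^ (i + 1)) := by
    refine antitone_nat_of_succ_le fun j => ?_
    rw [Finset.prod_range_succ]
    refine mul_le_of_le_one_right (prod_aux_pos h0 h1 j).le ?_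
    have : 0 < x ^ (j + 1) := by positivity
    linarith
  exact hanti.le_of_tendsto (tendsto_prod_aux h0 h1) j

/-- The weights, with `x = 1 / q`, after splitting the infinite product. -/
def auxWeight (x : ℝ) (m k : ℕ) : ℝ :=
  x ^ (k * (m + k)) * ((∏' i : ℕ, (1 - x ^ (i + 1))) /
    ((∏ i ∈ Finset.range k, (1 - x ^ (i + 1))) * ∏ i ∈ Finset.range (m + k), (1 - x ^ (i + 1))))

theorem auxWeight_nonneg (h0 : 0 < x) (h1 : x < 1) (m k : ℕ) : 0 ≤ auxWeight x m k := by
  have := tprod_aux_pos h0 h1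
  have := prod_aux_pos h0 h1 k
  have := prod_aux_pos h0 h1 (m + k)
  unfold auxWeight
  positivity

theorem auxWeight_le (h0 : 0 < x) (h1 : x < 1) (m k : ℕ) :
    auxWeight x m k ≤ x ^ (k * (m + k)) * (∏' i : ℕ, (1 - x ^ (i + 1)))⁻¹ := by
  have hE := tprod_aux_pos h0 h1
  have hk := tprod_le_prod h0 h1 k
  have hm := tprod_le_prod h0 h1 (m + k)
  have hk0 := (prod_aux_pos h0 h1 k).le
  unfold auxWeight
  refine mul_le_mul_of_nonneg_left ?_ (by positivity)
  set E := ∏' i : ℕ, (1 - x ^ (i + 1))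
  rw [div_le_iff₀ (mul_pos (hE.trans_le hk) (hE.trans_le hm))]
  calc E = E⁻¹ * (E * E) := by field_simp
    _ ≤ _ := by gcongr

theorem auxWeight_le' (h0 : 0 < x) (h1 : x < 1) (m k : ℕ) :
    auxWeight x m k ≤ x ^ k * (∏' i : ℕ, (1 - x ^ (i + 1)))⁻¹ := by
  refine (auxWeight_le h0 h1 m k).trans ?_
  refine mul_le_mul_of_nonneg_right ?_ (inv_nonneg.2 (tprod_aux_pos h0 h1).le)
  refine pow_le_pow_of_le_one h0.le h1.le ?_
  nlinarith [Nat.zero_le (k * m), Nat.le_mul_self k]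

theorem summable_auxWeight (h0 : 0 < x) (h1 : x < 1) (m : ℕ) : Summable (auxWeight x m) :=
  Summable.of_nonneg_of_le (auxWeight_nonneg h0 h1 m) (auxWeight_le' h0 h1 m)
    ((summable_geometric_of_lt_one h0.le h1).mul_right _)

theorem auxWeight_succ (h0 : 0 < x) (h1 : x < 1) (m k : ℕ) :
    auxWeight x (m + 1) k =
      x ^ k * auxWeight x m k + (1 - x ^ (k + 1)) * auxWeight x m (k + 1) := by
  have hk := (prod_aux_pos h0 h1 k).ne'
  have hm := (prod_aux_pos h0 h1 (m + k)).ne'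
  have h3 := (factor_pos h0 h1 k).ne'
  have h4 := (factor_pos h0 h1 (m + k)).ne'
  unfold auxWeight
  rw [show m + 1 + k = m + k + 1 by ring, show m + (k + 1) = m + k + 1 by ring,
    Finset.prod_range_succ _ (m + k), Finset.prod_range_succ _ k]
  field_simp
  ring

theorem tsum_auxWeight_succ (h0 : 0 < x) (h1 : x < 1) (m : ℕ) :
    ∑' k, auxWeight x (m + 1) k = ∑' k, auxWeight x m k := by
  have hs := summable_auxWeight h0 h1 m
  have hs1 : Summable fun k => x ^ k * auxWeight x m k :=
    Summable.of_nonneg_of_le (fun k => mul_nonneg (by positivity) (auxWeight_nonneg h0 h1 m k))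
      (fun k => mul_le_of_le_one_left (auxWeight_nonneg h0 h1 m k)
        (pow_le_one₀ h0.le h1.le)) hs
  have hs2 : Summable fun k => (1 - x ^ k) * auxWeight x m k := by
    simpa [sub_mul] using hs.sub hs1
  have hs3 := (summable_nat_add_iff 1).2 hs2
  have h5 := hs2.sum_add_tsum_nat_add 1
  simp only [Finset.sum_range_one, pow_zero, sub_self, zero_mul, zero_add] at h5
  simp_rw [auxWeight_succ h0 h1 m]
  rw [hs1.tsum_add hs3, h5, ← hs1.tsum_add hs2]
  refine tsum_congr fun k => ?_
  ring

theorem tsum_auxWeight (h0 : 0 < x) (h1 : x < 1) (m : ℕ) : ∑' k, auxWeight x m k = 1 := by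
  have hE := tprod_aux_pos h0 h1
  have hconst : ∀ j, ∑' k, auxWeight x j k = ∑' k, auxWeight x 0 k := by
    intro j
    induction j with
    | zero => rfl
    | succ j ih => rw [tsum_auxWeight_succ h0 h1, ih]
  have hlim : Filter.Tendsto (fun j => ∑' k, auxWeight x j k) Filter.atTop
      (nhds (∑' k, if k = 0 then (1 : ℝ) else 0)) := by
    refine tendsto_tsum_of_dominated_convergence
      (bound := fun k => x ^ k * (∏' i : ℕ, (1 - x ^ (i + 1)))⁻¹)
      ((summable_geometric_of_lt_one h0.le h1).mul_right _) (fun k => ?_)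
      (Filter.Eventually.of_forall fun j k => ?_)
    · rcases Nat.eq_zero_or_pos k with rfl | hk
      · have := (tendsto_prod_aux h0 h1).inv₀ hE.ne'
        have := this.const_mul (∏' i : ℕ, (1 - x ^ (i + 1)))
        rw [mul_inv_cancel₀ hE.ne'] at this
        simpa [auxWeight, div_eq_mul_inv] using this
      · rw [if_neg hk.ne']
        refine squeeze_zero (g := fun j => x ^ j * (∏' i : ℕ, (1 - x ^ (i + 1)))⁻¹)
          (fun j => auxWeight_nonneg h0 h1 j k) (fun j => ?_) ?_
        · refine (auxWeight_le h0 h1 j k).trans ?_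
          refine mul_le_mul_of_nonneg_right ?_ (inv_nonneg.2 hE.le)
          refine pow_le_pow_of_le_one h0.le h1.le ?_
          nlinarith
        · simpa using (tendsto_pow_atTop_nhds_zero_of_lt_one h0.le h1).mul_const
            (∏' i : ℕ, (1 - x ^ (i + 1)))⁻¹
    · rw [Real.norm_eq_abs, abs_of_nonneg (auxWeight_nonneg h0 h1 j k)]
      exact auxWeight_le' h0 h1 j k
  simp_rw [hconst] at hlim
  rw [hconst m, tendsto_nhds_unique tendsto_const_nhds hlim, tsum_ite_eq]

theorem limitWeight_eq {q : ℕ} (hq : 1 < q) (m k : ℕ) :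
    limitWeight q m k = auxWeight (1 / (q : ℝ)) m k := by
  have hq' : (1 : ℝ) < q := by exact_mod_cast hq
  have h0 : (0 : ℝ) < 1 / q := by positivity
  have h1 : (1 : ℝ) / q < 1 := (div_lt_one (by positivity)).2 hq'
  have hk := (prod_aux_pos h0 h1 k).ne'
  have hsplit := Multipliable.prod_mul_tprod_nat_mul'
    (f := fun i : ℕ => 1 - (1 / (q : ℝ)) ^ (i + 1)) (k := k)
    (by simpa [add_assoc] using multipliable_aux h0 h1 (k + 1))
  have hfin : ∏ i ∈ Finset.Icc 1 (m + k), (1 - 1 / (q : ℝ) ^ i) =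
      ∏ i ∈ Finset.range (m + k), (1 - (1 / (q : ℝ)) ^ (i + 1)) := by
    rw [Finset.range_eq_Ico, Finset.prod_Ico_add' (fun i => 1 - (1 / (q : ℝ)) ^ i) 0 (m + k) 1]
    simp only [one_div, inv_pow]
    rfl
  have hinf : ∏' i : ℕ, (1 - 1 / (q : ℝ) ^ (k + 1 + i)) =
      ∏' i : ℕ, (1 - (1 / (q : ℝ)) ^ (i + k + 1)) := by
    refine tprod_congr fun i => ?_
    rw [one_div_pow, show k + 1 + i = i + k + 1 by ring]
  rw [limitWeight, auxWeight, hfin, hinf, ← hsplit, one_div_pow, mul_div_mul_left _ _ hk]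

end Weights

/-- The limit law of the corank: the probability distribution on `ℕ` whose mass at `k` is
`limitWeight q m k`. -/
def limitLaw (q m : ℕ) (hq : 1 < q) : PMF ℕ :=
  ⟨fun k => ENNReal.ofReal (limitWeight q m k), by
    have hq' : (1 : ℝ) < q := by exact_mod_cast hq
    have h0 : (0 : ℝ) < 1 / q := by positivity
    have h1 : (1 : ℝ) / q < 1 := (div_lt_one (by positivity)).2 hq'
    simp_rw [limitWeight_eq hq]
    refine (ENNReal.summable.hasSum_iff).2 ?_
    rw [← ENNReal.ofReal_tsum_of_nonneg (auxWeight_nonneg h0 h1 m) (summable_auxWeight h0 h1 m),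
      tsum_auxWeight h0 h1 m, ENNReal.ofReal_one]⟩

end RandomCorank

end

/-! The corank is the dimension of the left kernel `V`, the space of vectors orthogonal to all
columns. Reveal the columns one at a time: a new column `y` keeps `V` if it is orthogonal to `V` and
otherwise cuts its dimension by one. For a uniform column the first event has probability `q ^ (-dim
V)`. The limit weights, extended by `rectWeight` to any number `t` of columns, satisfy exactly the
recursion of this uniform chain (`rectWeight_succ`), so only two errors need control: the one at `t
= 0` and the one made at each step.

At `t = 0` the corank is `n`, and the limit weights put all but at most `q ^ (-n)` of their mass
there. For a step, Fourier inversion writes the probability of orthogonality to `V` as `1 / |V|`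
times a sum over `v ∈ V`; the term `v = 0` gives the uniform value and the others are the error.
Averaged over the `t` earlier columns this error is small by three facts: `|V| ≥ q ^ (n - t)`
always; a fixed `v ≠ 0` lies in `V` with probability at most `(C / q) ^ t`; and by Parseval and
Cauchy–Schwarz the absolute Fourier coefficients sum to at most `(q √(C / q)) ^ n`. The powers of
`q` cancel, leaving `C ^ t √(C / q) ^ n` (`abs_corankExpect_succ_sub_le`).

Summing over the `n + m` columns suffices when `m ≤ n`. When `m > n` both laws are nearly
concentrated at `0`, and a union bound over nonzero `v` is enough
(`abs_corankExpect_sub_tsum_le_of_wide`). -/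

noncomputable section

namespace RandomCorank

/-! ### The limit weights as a trajectory of the uniform corank chain. -/

section LimitRecursion

/-- The limit weight of corank `k` for a matrix with `n` rows and `t` columns, where `t < n` is
allowed; `x = 1 / q`. -/
def rectWeight (x : ℝ) (n t k : ℕ) : ℝ :=
  if n ≤ t + k then
    x ^ (k * (t + k - n)) * ((∏' i : ℕ, (1 - x ^ (i + 1))) /
      ((∏ i ∈ Finset.range k, (1 - x ^ (i + 1))) *
        ∏ i ∈ Finset.range (t + k - n), (1 - x ^ (i + 1))))
  else 0

variable {x : ℝ}

theorem rectWeight_nonneg (h0 : 0 < x) (h1 : x < 1) (n t k : ℕ) : 0 ≤ rectWeight x n t k := by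
  have := tprod_aux_pos h0 h1
  have := prod_aux_pos h0 h1 k
  have := prod_aux_pos h0 h1 (t + k - n)
  unfold rectWeight
  split_ifs <;> positivity

theorem rectWeight_add (x : ℝ) (n m k : ℕ) : rectWeight x n (n + m) k = auxWeight x m k := by
  rw [rectWeight, if_pos (by omega), auxWeight, show n + m + k - n = m + k by omega]

/-- Apart from the infinite product, the weight is symmetric in the left corank `k` and the right
corank `t + k - n`; at `t = 0` exchanging them turns the weight into one of the limit law with
parameter `n`. -/
theorem rectWeight_zero_add (x : ℝ) (n k : ℕ) : rectWeight x n 0 (k + n) = auxWeight x n k := by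
  rw [rectWeight, if_pos (by omega), auxWeight, show 0 + (k + n) - n = k by omega, mul_comm (k + n),
    add_comm k n, mul_comm (∏ i ∈ Finset.range (n + k), (1 - x ^ (i + 1)))]

theorem rectWeight_zero_of_lt (x : ℝ) {n k : ℕ} (h : k < n) : rectWeight x n 0 k = 0 :=
  if_neg (by omega)

theorem rectWeight_succ (h0 : 0 < x) (h1 : x < 1) (n t k : ℕ) :
    rectWeight x n (t + 1) k =
      x ^ k * rectWeight x n t k + (1 - x ^ (k + 1)) * rectWeight x n t (k + 1) := by
  have hk := (prod_aux_pos h0 h1 k).ne'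
  have h3 := (factor_pos h0 h1 k).ne'
  rcases lt_or_ge (t + k) n with h | h
  · rcases lt_or_ge (t + 1 + k) n with h' | h'
    · simp [rectWeight, show ¬ n ≤ t + 1 + k by omega, show ¬ n ≤ t + k by omega,
        show ¬ n ≤ t + (k + 1) by omega]
    -- Boundary case `t + 1 + k = n`: the corank can only have come from `k + 1`, with the new
    -- column independent of the earlier ones.
    · have e1 : t + 1 + k - n = 0 := by omega
      have e2 : t + (k + 1) - n = 0 := by omega
      simp only [rectWeight, h', show ¬ n ≤ t + k by omega, show n ≤ t + (k + 1) by omega, if_true,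
        if_false, e1, e2, Finset.prod_range_succ _ k]
      field_simp
      simp
  · obtain ⟨b, hb⟩ := Nat.exists_eq_add_of_le h
    have e0 : t + k - n = b := by omega
    have e1 : t + 1 + k - n = b + 1 := by omega
    have e2 : t + (k + 1) - n = b + 1 := by omega
    have hm := (prod_aux_pos h0 h1 b).ne'
    have h4 := (factor_pos h0 h1 b).ne'
    simp only [rectWeight, h, show n ≤ t + 1 + k by omega, show n ≤ t + (k + 1) by omega, if_true,
        e0, e1, e2, Finset.prod_range_succ _ k, Finset.prod_range_succ _ b]
    field_simp
    ring

/-- One step of the corank chain of a uniform random matrix, acting on functions. -/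
def chainStep (x : ℝ) (f : ℕ → ℝ) (r : ℕ) : ℝ :=
  x ^ r * f r + (1 - x ^ r) * f (r - 1)

theorem chainStep_mem_Icc (h0 : 0 < x) (h1 : x < 1) {f : ℕ → ℝ} (hf : ∀ k, f k ∈ Set.Icc 0 1)
    (r : ℕ) : chainStep x f r ∈ Set.Icc 0 1 := by
  have hx : x ^ r ≤ 1 := pow_le_one₀ h0.le h1.le
  have hx0 : 0 < x ^ r := by positivity
  obtain ⟨a0, a1⟩ := hf r
  obtain ⟨b0, b1⟩ := hf (r - 1)
  refine ⟨?_, ?_⟩ <;> unfold chainStep <;> nlinarith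

theorem summable_mul_of_mem_Icc {w f : ℕ → ℝ} (hw : Summable w) (hw0 : ∀ k, 0 ≤ w k)
    (hf : ∀ k, f k ∈ Set.Icc (0 : ℝ) 1) : Summable fun k => w k * f k :=
  Summable.of_nonneg_of_le (fun k => mul_nonneg (hw0 k) (hf k).1)
    (fun k => mul_le_of_le_one_right (hw0 k) (hf k).2) hw

theorem hasSum_rectWeight_succ (h0 : 0 < x) (h1 : x < 1) {n t : ℕ}
    (hs : Summable (rectWeight x n t)) {f : ℕ → ℝ} (hf : ∀ k, f k ∈ Set.Icc 0 1) :
    HasSum (fun k => rectWeight x n (t + 1) k * f k)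
      (∑' k, rectWeight x n t k * chainStep x f k) := by
  have hw := rectWeight_nonneg h0 h1 n t
  have hx : ∀ r : ℕ, x ^ r ∈ Set.Icc (0 : ℝ) 1 := fun r =>
    ⟨by positivity, pow_le_one₀ h0.le h1.le⟩
  have s1 : Summable fun k => rectWeight x n t k * (x ^ k * f k) :=
    summable_mul_of_mem_Icc hs hw fun k =>
      ⟨mul_nonneg (hx k).1 (hf k).1, mul_le_one₀ (hx k).2 (hf k).1 (hf k).2⟩
  have s2 : Summable fun k => rectWeight x n t k * ((1 - x ^ k) * f (k - 1)) :=
    summable_mul_of_mem_Icc hs hw fun k =>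
      ⟨mul_nonneg (sub_nonneg.2 (hx k).2) (hf _).1,
        mul_le_one₀ (sub_le_self _ (hx k).1) (hf _).1 (hf _).2⟩
  have s3 : HasSum (fun k => rectWeight x n t (k + 1) * ((1 - x ^ (k + 1)) * f k))
      (∑' k, rectWeight x n t k * ((1 - x ^ k) * f (k - 1))) := by
    -- The shift drops only the term `k = 0`, which vanishes because `1 - x ^ 0 = 0`; for the same
    -- reason the truncated `0 - 1` in `chainStep` is harmless.
    have := (hasSum_nat_add_iff' 1).2 s2.hasSum
    simpa using this
  convert s1.hasSum.add s3 using 1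
  · funext k
    rw [rectWeight_succ h0 h1]
    ring
  · rw [← s1.tsum_add s2]
    refine tsum_congr fun k => ?_
    rw [chainStep]
    ring

theorem hasSum_rectWeight_zero (h0 : 0 < x) (h1 : x < 1) (n : ℕ) :
    HasSum (rectWeight x n 0) 1 := by
  have h := (summable_auxWeight h0 h1 n).hasSum
  rw [tsum_auxWeight h0 h1] at h
  have h2 := (hasSum_nat_add_iff (f := rectWeight x n 0) n).1
    (by simpa only [rectWeight_zero_add] using h)
  rwa [Finset.sum_eq_zero fun i hi => rectWeight_zero_of_lt x (Finset.mem_range.1 hi),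
    add_zero] at h2

theorem hasSum_rectWeight (h0 : 0 < x) (h1 : x < 1) (n t : ℕ) :
    HasSum (rectWeight x n t) 1 := by
  induction t with
  | zero => exact hasSum_rectWeight_zero h0 h1 n
  | succ t ih =>
    have h := hasSum_rectWeight_succ h0 h1 ih.summable (f := fun _ => 1) (by simp)
    simpa [chainStep, ih.tsum_eq] using h

/-- The mass at `0` is `∏_{i > m} (1 - x ^ i) ≥ 1 - ∑_{i > m} x ^ i`, and for `x ≤ 1 / 2` the
geometric tail is at most `x ^ m`. -/
theorem one_sub_auxWeight_zero_le (h0 : 0 < x) (h2 : x ≤ 1 / 2) (m : ℕ) :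
    1 - auxWeight x m 0 ≤ x ^ m := by
  have h1 : x < 1 := by linarith
  have hm := prod_aux_pos h0 h1 m
  -- The extra term `x ^ (m + i)` makes the induction close: with `a = x ^ (m + i)`, the step needs
  -- `a * (1 - 2 * x + x * (x ^ m - a)) ≥ 0`.
  have key : ∀ i, (∏ l ∈ Finset.range m, (1 - x ^ (l + 1))) * (1 - x ^ m + x ^ (m + i)) ≤
      ∏ l ∈ Finset.range (m + i), (1 - x ^ (l + 1)) := by
    intro i
    induction i with
    | zero => simp
    | succ i ih =>
      rw [← add_assoc, Finset.prod_range_succ]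
      refine le_trans ?_ (mul_le_mul_of_nonneg_right ih (factor_pos h0 h1 _).le)
      rw [mul_assoc]
      refine mul_le_mul_of_nonneg_left ?_ hm.le
      have a : 0 < x ^ (m + i) := by positivity
      have b : x ^ (m + i) ≤ x ^ m := pow_le_pow_of_le_one h0.le h1.le (by omega)
      rw [pow_succ]
      nlinarith [mul_pos a h0, mul_nonneg (mul_pos a h0).le (sub_nonneg.2 b)]
  have hlim := (tendsto_prod_aux h0 h1).comp (Filter.tendsto_add_atTop_nat m)
  have : (∏ l ∈ Finset.range m, (1 - x ^ (l + 1))) * (1 - x ^ m) ≤ ∏' i : ℕ, (1 - x ^ (i + 1)) := by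
    refine ge_of_tendsto' hlim fun i => le_trans ?_ ((key i).trans_eq (by simp [add_comm]))
    refine mul_le_mul_of_nonneg_left ?_ hm.le
    have : 0 < x ^ (m + i) := by positivity
    linarith
  have h3 : 1 - x ^ m ≤ auxWeight x m 0 := by
    rw [auxWeight]
    simp only [zero_mul, pow_zero, one_mul, Finset.range_zero, Finset.prod_empty, add_zero]
    rw [le_div_iff₀ hm, mul_comm]
    exact this
  linarith

/-- A probability distribution on `ℕ` integrates `f` to within its mass off `a` of `f a`. -/
theorem abs_sub_tsum_le {w f : ℕ → ℝ} (hw : HasSum w 1) (hw0 : ∀ k, 0 ≤ w k)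
    (hf : ∀ k, f k ∈ Set.Icc (0 : ℝ) 1) (a : ℕ) :
    |f a - ∑' k, w k * f k| ≤ 1 - w a := by
  have s := summable_mul_of_mem_Icc hw.summable hw0 hf
  have lo : w a * f a ≤ ∑' k, w k * f k :=
    s.le_tsum a fun k _ => mul_nonneg (hw0 k) (hf k).1
  have hi : w a * (1 - f a) ≤ ∑' k, w k * (1 - f k) := by
    refine Summable.le_tsum ?_ a fun k _ => mul_nonneg (hw0 k) (sub_nonneg.2 (hf k).2)
    simpa [mul_sub] using hw.summable.sub s
  have e : ∑' k, w k * (1 - f k) = 1 - ∑' k, w k * f k := by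
    simp_rw [mul_sub, mul_one]
    rw [hw.summable.tsum_sub s, hw.tsum_eq]
  have h1 : w a ≤ 1 := hw.tsum_eq ▸ hw.summable.le_tsum a fun k _ => hw0 k
  obtain ⟨f0, f1⟩ := hf a
  rw [e] at hi
  rw [abs_le]
  constructor <;> nlinarith [hw0 a]

end LimitRecursion

/-! ### Fourier analysis of near uniform vectors. -/

section Fourier

variable {F : Type*} [Field F] [Fintype F]

/-- `μ` is the mass function of a near uniform distribution on `F`, with constant `C`. -/
structure IsNearUniformMass (C : ℝ) (μ : F → ℝ) : Prop where
  nonneg : ∀ a, 0 ≤ μ a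
  sum_eq_one : ∑ a, μ a = 1
  le : ∀ a, μ a ≤ C / Fintype.card F

/-- A fixed nontrivial additive character of a finite field. -/
def stdChar (F : Type*) [Field F] [Fintype F] : AddChar F ℂ :=
  AddChar.FiniteField.primitiveChar_to_Complex F

theorem stdChar_isPrimitive : (stdChar F).IsPrimitive :=
  AddChar.FiniteField.primitiveChar_to_Complex_isPrimitive F

/-- The Fourier transform of a function on a finite field. -/
def fourier (μ : F → ℝ) (b : F) : ℂ := ∑ a, (μ a : ℂ) * stdChar F (b * a)

-- Parseval's identity, from orthogonality of additive characters.
open Classical in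
theorem sum_norm_sq_fourier (μ : F → ℝ) :
    ∑ b, ‖fourier μ b‖ ^ 2 = Fintype.card F * ∑ a, μ a ^ 2 := by
  have key : ∑ b, fourier μ b * (starRingEnd ℂ) (fourier μ b) =
      (Fintype.card F : ℂ) * ∑ a, (μ a : ℂ) ^ 2 := by
    have e : ∀ b, fourier μ b * (starRingEnd ℂ) (fourier μ b) =
        ∑ a, ∑ a', (μ a : ℂ) * μ a' * stdChar F (b * (a - a')) := by
      intro b
      rw [fourier, map_sum, Finset.sum_mul_sum]
      refine Finset.sum_congr rfl fun a _ => Finset.sum_congr rfl fun a' _ => ?_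
      rw [map_mul (starRingEnd ℂ), Complex.conj_ofReal, ← AddChar.map_neg_eq_conj, mul_sub, sub_eq_add_neg,
        AddChar.map_add_eq_mul]
      ring
    simp_rw [e]
    rw [Finset.sum_comm, Finset.mul_sum]
    refine Finset.sum_congr rfl fun a _ => ?_
    rw [Finset.sum_comm, Finset.sum_eq_single a]
    · simp [pow_two, mul_comm]
    · intro a' _ h
      rw [← Finset.mul_sum, AddChar.sum_mulShift _ stdChar_isPrimitive,
        if_neg (sub_ne_zero.2 h.symm)]
      simp
    · simp
  have : ((∑ b, ‖fourier μ b‖ ^ 2 : ℝ) : ℂ) = ((Fintype.card F * ∑ a, μ a ^ 2 : ℝ) : ℂ) := by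
    push_cast
    rw [← key]
    exact Finset.sum_congr rfl fun b _ => (RCLike.mul_conj _).symm
  exact_mod_cast this

theorem card_pos_real : (0 : ℝ) < Fintype.card F := by exact_mod_cast Fintype.card_pos

/-- Cauchy–Schwarz and Parseval, with `∑ μ ^ 2 ≤ max μ ≤ C / q`. This gains a factor `√(C / q)` per
coordinate over the trivial bound `q`. -/
theorem IsNearUniformMass.sum_norm_fourier_le {C : ℝ} {μ : F → ℝ} (h : IsNearUniformMass C μ) :
    ∑ b, ‖fourier μ b‖ ≤ Fintype.card F * √(C / Fintype.card F) := by
  have hq := card_pos_real (F := F)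
  have h1 : ∑ a, μ a ^ 2 ≤ C / Fintype.card F := by
    calc ∑ a, μ a ^ 2 ≤ ∑ a, C / Fintype.card F * μ a :=
          Finset.sum_le_sum fun a _ => by
            rw [pow_two]; exact mul_le_mul_of_nonneg_right (h.le a) (h.nonneg a)
      _ = C / Fintype.card F := by rw [← Finset.mul_sum, h.sum_eq_one, mul_one]
  have h2 : (∑ b, ‖fourier μ b‖) ^ 2 ≤ (Fintype.card F : ℝ) ^ 2 * (C / Fintype.card F) := by
    refine sq_sum_le_card_mul_sum_sq.trans ?_
    rw [sum_norm_sq_fourier, Finset.card_univ, ← mul_assoc, ← pow_two]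
    gcongr
  calc ∑ b, ‖fourier μ b‖ ≤ √((Fintype.card F : ℝ) ^ 2 * (C / Fintype.card F)) :=
        Real.le_sqrt_of_sq_le h2
    _ = _ := by rw [Real.sqrt_mul (by positivity), Real.sqrt_sq hq.le]

theorem map_sum_eq_prod {ι A R : Type*} [AddCommMonoid A] [CommMonoid R] (ψ : AddChar A R)
    (s : Finset ι) (f : ι → A) : ψ (∑ i ∈ s, f i) = ∏ i ∈ s, ψ (f i) :=
  map_prod ψ.toMonoidHom (fun i => Multiplicative.ofAdd (f i)) s

/-- The mass function of a vector with independent coordinates. -/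
def prodMass {ι α : Type*} [Fintype ι] (μ : ι → α → ℝ) (y : ι → α) : ℝ := ∏ i, μ i (y i)

theorem prodMass_nonneg {ι α : Type*} [Fintype ι] {μ : ι → α → ℝ} (h : ∀ i a, 0 ≤ μ i a)
    (y : ι → α) : 0 ≤ prodMass μ y := Finset.prod_nonneg fun i _ => h i _

theorem sum_prodMass {ι α : Type*} [Fintype ι] [DecidableEq ι] [Fintype α] {μ : ι → α → ℝ}
    (h : ∀ i, ∑ a, μ i a = 1) : ∑ y, prodMass μ y = 1 := by
  have := Finset.prod_univ_sum (fun _ : ι => (Finset.univ : Finset α)) μ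
  rw [Fintype.piFinset_univ] at this
  simp only [prodMass, ← this, h, Finset.prod_const_one]

variable {n : ℕ}

open Classical in
/-- Fourier expansion of the probability that a random vector is orthogonal to `V`. -/
theorem card_mul_sum_prodMass (μ : Fin n → F → ℝ) (V : Submodule F (Fin n → F)) :
    (Fintype.card V : ℂ) *
        ((∑ y, prodMass μ y * if ∀ v ∈ V, y ⬝ᵥ v = 0 then 1 else 0 : ℝ) : ℂ) =
      ∑ v : V, ∏ i, fourier (μ i) ((v : Fin n → F) i) := by
  have e : ∀ v : V, ∏ i, fourier (μ i) ((v : Fin n → F) i) =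
      ∑ y, (prodMass μ y : ℂ) * stdChar F (y ⬝ᵥ (v : Fin n → F)) := by
    intro v
    simp only [fourier]
    rw [Finset.prod_univ_sum, Fintype.piFinset_univ]
    refine Finset.sum_congr rfl fun y _ => ?_
    rw [Finset.prod_mul_distrib, dotProduct, map_sum_eq_prod, prodMass]
    push_cast
    simp only [mul_comm]
  simp_rw [e]
  rw [Finset.sum_comm]
  push_cast
  rw [Finset.mul_sum]
  refine Finset.sum_congr rfl fun y _ => ?_
  rw [← Finset.mul_sum, mul_left_comm]
  congr 1
  let φ : V →+ F := ((dotProductBilin F F y).comp V.subtype).toAddMonoidHom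
  have hφ : ∀ v : V, (stdChar F).compAddMonoidHom φ v = stdChar F (y ⬝ᵥ (v : Fin n → F)) :=
    fun v => rfl
  simp_rw [← hφ]
  rw [AddChar.sum_eq_ite]
  by_cases h : ∀ v ∈ V, y ⬝ᵥ v = 0
  · rw [if_pos h, if_pos, Complex.ofReal_one, mul_one]
    ext v
    rw [hφ, h v v.2]
    simp
  · rw [if_neg h, if_neg, Complex.ofReal_zero, mul_zero]
    intro h0
    push Not at h
    obtain ⟨v, hv, hne⟩ := h
    -- If `v ↦ ψ (y ⬝ᵥ v)` were trivial on `V`, it would be trivial on the line through `v`, making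
    -- the shift of `ψ` by the nonzero scalar `y ⬝ᵥ v` trivial.
    refine stdChar_isPrimitive hne ?_
    ext a
    have := hφ ⟨a • v, V.smul_mem a hv⟩
    rw [h0] at this
    simpa [mul_comm, AddChar.mulShift_apply] using this.symm

-- The term `v = 0` of the Fourier expansion equals `1` and yields the uniform probability `1 /
-- |V|`; the rest is bounded by the triangle inequality.
open Classical in
theorem abs_sum_prodMass_sub_le {C : ℝ} {μ : Fin n → F → ℝ} (h : ∀ i, IsNearUniformMass C (μ i))
    (V : Submodule F (Fin n → F)) :
    |(∑ y, prodMass μ y * if ∀ v ∈ V, y ⬝ᵥ v = 0 then 1 else 0) -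
        (1 / (Fintype.card F : ℝ)) ^ Module.finrank F V| ≤
      (1 / (Fintype.card F : ℝ)) ^ Module.finrank F V *
        ∑ v : Fin n → F, if v ∈ V ∧ v ≠ 0 then ∏ i, ‖fourier (μ i) (v i)‖ else 0 := by
  set p := ∑ y, prodMass μ y * if ∀ v ∈ V, y ⬝ᵥ v = 0 then (1 : ℝ) else 0
  have hcard : (1 / (Fintype.card F : ℝ)) ^ Module.finrank F V = (Fintype.card V : ℝ)⁻¹ := by
    rw [Module.card_eq_pow_finrank (K := F) (V := V)]
    simp
  have hV : (0 : ℝ) < Fintype.card V := by exact_mod_cast Fintype.card_pos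
  have hf := card_mul_sum_prodMass μ V
  have hzero : ∏ i, fourier (μ i) (((0 : V) : Fin n → F) i) = 1 := by
    refine Finset.prod_eq_one fun i _ => ?_
    simp only [fourier, ZeroMemClass.coe_zero, Pi.zero_apply, zero_mul, AddChar.map_zero_eq_one,
      mul_one]
    exact_mod_cast (h i).sum_eq_one
  rw [← Finset.add_sum_erase _ _ (Finset.mem_univ (0 : V)), hzero] at hf
  have h2 : |Fintype.card V * p - 1| ≤
      ∑ v ∈ Finset.univ.erase (0 : V), ∏ i, ‖fourier (μ i) ((v : Fin n → F) i)‖ := by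
    calc |Fintype.card V * p - 1| = ‖((Fintype.card V * p - 1 : ℝ) : ℂ)‖ := by
          rw [Complex.norm_real, Real.norm_eq_abs]
      _ = ‖∑ v ∈ Finset.univ.erase (0 : V), ∏ i, fourier (μ i) ((v : Fin n → F) i)‖ := by
          rw [Complex.ofReal_sub, Complex.ofReal_mul, Complex.ofReal_natCast, Complex.ofReal_one, hf, add_sub_cancel_left]
      _ ≤ _ := (norm_sum_le _ _).trans_eq (Finset.sum_congr rfl fun v _ => norm_prod _ _)
  have h3 : ∑ v ∈ Finset.univ.erase (0 : V), ∏ i, ‖fourier (μ i) ((v : Fin n → F) i)‖ =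
      ∑ v : Fin n → F, if v ∈ V ∧ v ≠ 0 then ∏ i, ‖fourier (μ i) (v i)‖ else 0 := by
    rw [← Finset.sum_filter]
    refine Finset.sum_nbij (fun v => (v : Fin n → F)) ?_ ?_ ?_ ?_
    · intro v hv
      simpa using hv
    · exact Subtype.val_injective.injOn
    · intro v hv
      have hv' := (Finset.mem_filter.1 hv).2
      exact ⟨⟨v, hv'.1⟩, by simpa using hv'.2, rfl⟩
    · intro v _
      rfl
  rw [h3] at h2
  rw [hcard, show p - (Fintype.card V : ℝ)⁻¹ = (Fintype.card V : ℝ)⁻¹ * (Fintype.card V * p - 1) by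
    field_simp, abs_mul, abs_of_pos (inv_pos.2 hV)]
  exact mul_le_mul_of_nonneg_left h2 (inv_pos.2 hV).le

theorem sum_prod_norm_fourier_le {C : ℝ} {μ : Fin n → F → ℝ}
    (h : ∀ i, IsNearUniformMass C (μ i)) :
    ∑ v : Fin n → F, ∏ i, ‖fourier (μ i) (v i)‖ ≤
      (Fintype.card F * √(C / Fintype.card F)) ^ n := by
  have := Finset.prod_univ_sum (fun _ : Fin n => (Finset.univ : Finset F))
    fun i b => ‖fourier (μ i) b‖
  rw [Fintype.piFinset_univ] at this
  rw [← this]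
  refine (Finset.prod_le_prod (fun i _ => Finset.sum_nonneg fun b _ => norm_nonneg _)
    fun i _ => (h i).sum_norm_fourier_le).trans_eq ?_
  simp

-- Fix all coordinates of `y` but one where `v` is nonzero: orthogonality then forces a single value
-- of that coordinate.
open Classical in
theorem sum_prodMass_dotProduct_le {C : ℝ} {μ : Fin n → F → ℝ}
    (h : ∀ i, IsNearUniformMass C (μ i)) {v : Fin n → F} (hv : v ≠ 0) :
    (∑ y, prodMass μ y * if y ⬝ᵥ v = 0 then 1 else 0) ≤ C / Fintype.card F := by
  obtain ⟨i₀, hi⟩ := Function.ne_iff.1 hv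
  obtain _ | n := n
  · exact i₀.elim0
  rw [← (Fin.insertNthEquiv (fun _ => F) i₀).sum_comp, Fintype.sum_prod_type_right]
  have key : ∀ z : Fin n → F, (∑ a, prodMass μ (i₀.insertNth a z : Fin (n + 1) → F) *
      if (i₀.insertNth a z : Fin (n + 1) → F) ⬝ᵥ v = 0 then (1 : ℝ) else 0) ≤
        C / Fintype.card F * prodMass (fun i => μ (i₀.succAbove i)) z := by
    intro z
    have hz : 0 ≤ prodMass (fun i => μ (i₀.succAbove i)) z :=
      prodMass_nonneg (fun i => (h _).nonneg) z
    set b := -(∑ i, z i * v (i₀.succAbove i)) / v i₀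
    rw [Finset.sum_eq_single b]
    · refine (mul_le_of_le_one_right (prodMass_nonneg (fun i => (h i).nonneg) _)
        (by split_ifs <;> norm_num)).trans ?_
      rw [prodMass, Fin.prod_univ_succAbove _ i₀]
      simp only [Fin.insertNth_apply_same, Fin.insertNth_apply_succAbove]
      exact mul_le_mul_of_nonneg_right ((h i₀).le b) hz
    · intro a _ ha
      rw [if_neg, mul_zero]
      intro h0
      rw [dotProduct, Fin.sum_univ_succAbove _ i₀] at h0
      simp only [Fin.insertNth_apply_same, Fin.insertNth_apply_succAbove] at h0
      exact ha (by rw [eq_div_iff hi]; exact eq_neg_of_add_eq_zero_left h0)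
    · simp
  refine (Finset.sum_le_sum fun z _ => key z).trans_eq ?_
  rw [← Finset.mul_sum, sum_prodMass (fun i => (h _).sum_eq_one), mul_one]

end Fourier

/-! ### The joint mass function of independent columns. -/

section Columns

variable {F : Type*} [Fintype F] {n t : ℕ} {C : ℝ} {μ : Fin t → Fin n → F → ℝ}

theorem prodMass_prodMass_nonneg (h : ∀ j i, IsNearUniformMass C (μ j i))
    (x : Fin t → Fin n → F) : 0 ≤ prodMass (fun j => prodMass (μ j)) x :=
  prodMass_nonneg (fun j => prodMass_nonneg fun i => (h j i).nonneg) x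

theorem sum_prodMass_prodMass [DecidableEq F] (h : ∀ j i, IsNearUniformMass C (μ j i)) :
    ∑ x, prodMass (fun j => prodMass (μ j)) x = 1 :=
  sum_prodMass fun j => sum_prodMass fun i => (h j i).sum_eq_one

end Columns

/-! ### The left kernel as columns are added. -/

section Chain

variable {F : Type*} [Field F] {n t : ℕ}

/-- The vectors orthogonal to all the columns `x j`. -/
def leftKernel (x : Fin t → Fin n → F) : Submodule F (Fin n → F) :=
  LinearMap.ker (Matrix.of x).mulVecLin

theorem mem_leftKernel {x : Fin t → Fin n → F} {v : Fin n → F} :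
    v ∈ leftKernel x ↔ ∀ j, x j ⬝ᵥ v = 0 := by
  rw [leftKernel, LinearMap.mem_ker, Matrix.mulVecLin_apply, funext_iff]
  rfl

theorem rank_add_finrank_leftKernel (x : Fin t → Fin n → F) :
    (Matrix.of x).rank + Module.finrank F (leftKernel x) = n := by
  have := LinearMap.finrank_range_add_finrank_ker (Matrix.of x).mulVecLin
  rwa [Module.finrank_fin_fun] at this

theorem corank_of_eq_finrank_leftKernel (X : Fin n → Fin t → F) :
    corank (Matrix.of X) = Module.finrank F (leftKernel fun j i => X i j) := by
  have h := rank_add_finrank_leftKernel fun j i => X i j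
  have e : Matrix.of (fun j i => X i j) = (Matrix.of X).transpose := rfl
  rw [e, Matrix.rank_transpose] at h
  rw [corank]
  omega

theorem le_add_finrank_leftKernel (x : Fin t → Fin n → F) :
    n ≤ t + Module.finrank F (leftKernel x) := by
  have h1 := rank_add_finrank_leftKernel x
  have h2 := Matrix.rank_le_height (Matrix.of x)
  omega

theorem leftKernel_cons (y : Fin n → F) (x : Fin t → Fin n → F) :
    leftKernel (Fin.cons y x : Fin (t + 1) → Fin n → F) =
      leftKernel x ⊓ LinearMap.ker (dotProductBilin F F y) := by
  ext v
  rw [Submodule.mem_inf, mem_leftKernel, mem_leftKernel, Fin.forall_fin_succ, and_comm]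
  rfl

theorem finrank_leftKernel_cons (y : Fin n → F) (x : Fin t → Fin n → F) :
    Module.finrank F (leftKernel (Fin.cons y x : Fin (t + 1) → Fin n → F)) =
      Module.finrank F ↥(leftKernel x ⊓ LinearMap.ker (dotProductBilin F F y)) := by
  rw [leftKernel_cons]

/-- A functional that is nonzero on `V` has a kernel of codimension one in `V`. -/
theorem finrank_inf_ker_of_not_le {V : Submodule F (Fin n → F)} {φ : Module.Dual F (Fin n → F)}
    (h : ¬ ∀ v ∈ V, φ v = 0) :
    Module.finrank F ↥(V ⊓ LinearMap.ker φ) = Module.finrank F V - 1 := by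
  have h0 : φ.comp V.subtype ≠ 0 := fun h0 =>
    h fun v hv => LinearMap.congr_fun h0 ⟨v, hv⟩
  have := Module.Dual.finrank_ker_add_one_of_ne_zero h0
  rw [LinearMap.ker_comp, ← Submodule.finrank_map_subtype_eq, Submodule.map_comap_subtype] at this
  omega

theorem finrank_inf_ker_of_le {V : Submodule F (Fin n → F)} {φ : Module.Dual F (Fin n → F)}
    (h : ∀ v ∈ V, φ v = 0) :
    Module.finrank F ↥(V ⊓ LinearMap.ker φ) = Module.finrank F V := by
  rw [inf_eq_left.2 fun v hv => LinearMap.mem_ker.2 (h v hv)]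

theorem sum_prodMass_succ {α : Type*} [Fintype α] (ν : Fin (t + 1) → α → ℝ)
    (G : (Fin (t + 1) → α) → ℝ) :
    ∑ x, prodMass ν x * G x =
      ∑ x, prodMass (Fin.tail ν) x * ∑ y, ν 0 y * G (Fin.cons y x) := by
  rw [← (Fin.consEquiv fun _ => α).sum_comp, Fintype.sum_prod_type_right]
  refine Finset.sum_congr rfl fun x _ => ?_
  rw [Finset.mul_sum]
  refine Finset.sum_congr rfl fun y _ => ?_
  simp only [prodMass, Fin.consEquiv_apply, Fin.prod_univ_succ, Fin.cons_zero, Fin.cons_succ,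
    Fin.tail]
  change _ * G (Fin.cons y x) = _
  ring

variable [Fintype F]

/-- The expectation of `f` at the corank of the matrix with independent entries whose `j`-th column
has entries distributed as `μ j`. -/
def corankExpect (μ : Fin t → Fin n → F → ℝ) (f : ℕ → ℝ) : ℝ :=
  ∑ x, prodMass (fun j => prodMass (μ j)) x * f (Module.finrank F (leftKernel x))

variable {C : ℝ} {μ : Fin t → Fin n → F → ℝ}

-- The columns are independent, and each is orthogonal to `v` with probability at most `C / q`.
open Classical in
theorem sum_mem_leftKernel_le (h : ∀ j i, IsNearUniformMass C (μ j i)) {v : Fin n → F}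
    (hv : v ≠ 0) :
    (∑ x, prodMass (fun j => prodMass (μ j)) x * if v ∈ leftKernel x then 1 else 0) ≤
      (C / Fintype.card F) ^ t := by
  have e := Finset.prod_univ_sum (fun _ : Fin t => (Finset.univ : Finset (Fin n → F)))
    fun j y => prodMass (μ j) y * if y ⬝ᵥ v = 0 then 1 else 0
  rw [Fintype.piFinset_univ] at e
  have e2 : (∑ x, prodMass (fun j => prodMass (μ j)) x * if v ∈ leftKernel x then 1 else 0) =
      ∏ j : Fin t, ∑ y, prodMass (μ j) y * if y ⬝ᵥ v = 0 then 1 else 0 := by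
    rw [e]
    refine Finset.sum_congr rfl fun x _ => ?_
    rw [Finset.prod_mul_distrib, Finset.prod_boole]
    simp only [mem_leftKernel, Finset.mem_univ, true_imp_iff, prodMass]
  rw [e2]
  refine (Finset.prod_le_prod (fun j _ => Finset.sum_nonneg fun y _ => ?_)
    fun j _ => sum_prodMass_dotProduct_le (h j) hv).trans_eq
      (by rw [Finset.prod_const, Finset.card_univ, Fintype.card_fin])
  exact mul_nonneg (prodMass_nonneg (fun i => (h j i).nonneg) y) (by split_ifs <;> norm_num)

open Classical in
/-- Adding a column to a matrix with left kernel `V` moves the corank as in the uniform case, up to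
an error which is a Fourier sum over `V`. -/
theorem abs_sum_inf_sub_chainStep_le {μ : Fin n → F → ℝ} (h : ∀ i, IsNearUniformMass C (μ i))
    (V : Submodule F (Fin n → F)) {f : ℕ → ℝ} (hf : ∀ k, f k ∈ Set.Icc 0 1) :
    |∑ y, prodMass μ y *
          f (Module.finrank F ↥(V ⊓ LinearMap.ker (dotProductBilin F F y))) -
        chainStep (1 / (Fintype.card F : ℝ)) f (Module.finrank F V)| ≤
      (1 / (Fintype.card F : ℝ)) ^ Module.finrank F V *
        ∑ v : Fin n → F, if v ∈ V ∧ v ≠ 0 then ∏ i, ‖fourier (μ i) (v i)‖ else 0 := by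
  refine le_trans ?_ (abs_sum_prodMass_sub_le h V)
  set p := ∑ y, prodMass μ y * if ∀ v ∈ V, y ⬝ᵥ v = 0 then (1 : ℝ) else 0 with hp
  set r := Module.finrank F V
  have e : ∑ y, prodMass μ y * f (Module.finrank F ↥(V ⊓ LinearMap.ker (dotProductBilin F F y))) =
      p * f r + (1 - p) * f (r - 1) := by
    have e1 : ∀ y, f (Module.finrank F ↥(V ⊓ LinearMap.ker (dotProductBilin F F y))) =
        (if ∀ v ∈ V, y ⬝ᵥ v = 0 then (1 : ℝ) else 0) * (f r - f (r - 1)) + f (r - 1) := by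
      intro y
      split_ifs with hy
      · rw [finrank_inf_ker_of_le (φ := dotProductBilin F F y) hy]
        ring
      · rw [finrank_inf_ker_of_not_le (φ := dotProductBilin F F y) hy]
        ring
    simp_rw [e1, mul_add, ← mul_assoc]
    rw [Finset.sum_add_distrib, ← Finset.sum_mul, ← Finset.sum_mul, ← hp,
      sum_prodMass fun i => (h i).sum_eq_one]
    ring
  -- The difference factors as `(p - q ^ (-r)) * (f r - f (r - 1))`, and the second factor has
  -- absolute value at most `1`.
  rw [e, chainStep, show p * f r + (1 - p) * f (r - 1) -
    ((1 / (Fintype.card F : ℝ)) ^ r * f r + (1 - (1 / (Fintype.card F : ℝ)) ^ r) * f (r - 1)) =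
    (p - (1 / (Fintype.card F : ℝ)) ^ r) * (f r - f (r - 1)) by ring, abs_mul]
  refine mul_le_of_le_one_right (abs_nonneg _) (abs_le.2 ⟨?_, ?_⟩) <;>
    linarith [(hf r).1, (hf r).2, (hf (r - 1)).1, (hf (r - 1)).2]

-- Conditionally on the other columns the error is a Fourier sum over the nonzero vectors of their
-- left kernel. Taking the expectation inside the sum replaces membership in this random kernel by
-- its probability.
open Classical in
theorem abs_corankExpect_succ_sub_le {μ : Fin (t + 1) → Fin n → F → ℝ}
    (hC : 0 ≤ C) (h : ∀ j i, IsNearUniformMass C (μ j i)) {f : ℕ → ℝ}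
    (hf : ∀ k, f k ∈ Set.Icc 0 1) :
    |corankExpect μ f - corankExpect (Fin.tail μ) (chainStep (1 / (Fintype.card F : ℝ)) f)| ≤
      C ^ t * √(C / Fintype.card F) ^ n := by
  have hq := card_pos_real (F := F)
  have hq1 : (1 : ℝ) ≤ Fintype.card F := by exact_mod_cast Fintype.card_pos (α := F)
  set q : ℝ := (Fintype.card F : ℝ)
  have ht : ∀ j i, IsNearUniformMass C (Fin.tail μ j i) := fun j i => h j.succ i
  set Φ : (Fin n → F) → ℝ := fun v => ∏ i, ‖fourier (μ 0 i) (v i)‖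
  have hΦ : ∀ v, 0 ≤ Φ v := fun v => Finset.prod_nonneg fun i _ => norm_nonneg _
  set W := prodMass (fun j => prodMass (Fin.tail μ j))
  have hW : ∀ x, 0 ≤ W x := prodMass_prodMass_nonneg ht
  -- Each column lowers the dimension by at most one, so `|V| ≥ q ^ (n - t)`; the form `q ^ t * (1 /
  -- q) ^ n` remains valid for `t > n`.
  have hr : ∀ x : Fin t → Fin n → F,
      (1 / q) ^ Module.finrank F (leftKernel x) ≤ q ^ t * (1 / q) ^ n := by
    intro x
    calc (1 / q) ^ Module.finrank F (leftKernel x)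
        = q ^ t * (1 / q) ^ (t + Module.finrank F (leftKernel x)) := by
          rw [pow_add, ← mul_assoc, ← mul_pow, mul_one_div_cancel hq.ne', one_pow, one_mul]
      _ ≤ q ^ t * (1 / q) ^ n := mul_le_mul_of_nonneg_left
          (pow_le_pow_of_le_one (by positivity) ((div_le_one hq).2 hq1)
            (le_add_finrank_leftKernel x)) (by positivity)
  have htail : Fin.tail (fun j => prodMass (μ j)) = fun j => prodMass (Fin.tail μ j) := rfl
  -- Column `0` is treated as the last one revealed, conditionally on the tail.
  rw [corankExpect, sum_prodMass_succ, htail, corankExpect, ← Finset.sum_sub_distrib]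
  simp_rw [← mul_sub, finrank_leftKernel_cons]
  calc _ ≤ ∑ x, W x * (q ^ t * (1 / q) ^ n *
        ∑ v : Fin n → F, if v ∈ leftKernel x ∧ v ≠ 0 then Φ v else 0) := by
        refine (Finset.abs_sum_le_sum_abs _ _).trans (Finset.sum_le_sum fun x _ => ?_)
        rw [abs_mul]
        refine mul_le_mul (abs_of_nonneg (hW x)).le ?_ (abs_nonneg _) (hW x)
        refine (abs_sum_inf_sub_chainStep_le (h 0) (leftKernel x) hf).trans ?_
        exact mul_le_mul_of_nonneg_right (hr x)
          (Finset.sum_nonneg fun v _ => by split_ifs <;> [exact hΦ v; exact le_rfl])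
    _ = q ^ t * (1 / q) ^ n * ∑ v : Fin n → F,
          ∑ x, W x * if v ∈ leftKernel x ∧ v ≠ 0 then Φ v else 0 := by
        rw [Finset.sum_comm, Finset.mul_sum]
        refine Finset.sum_congr rfl fun x _ => ?_
        rw [mul_left_comm, Finset.mul_sum]
    _ ≤ q ^ t * (1 / q) ^ n * ∑ v : Fin n → F, (C / q) ^ t * Φ v := by
        refine mul_le_mul_of_nonneg_left (Finset.sum_le_sum fun v _ => ?_) (by positivity)
        by_cases hv : v = 0
        · simpa [hv] using mul_nonneg (by positivity : 0 ≤ (C / q) ^ t) (hΦ 0)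
        · refine le_trans (le_of_eq ?_)
            (mul_le_mul_of_nonneg_right (sum_mem_leftKernel_le ht hv) (hΦ v))
          rw [Finset.sum_mul]
          refine Finset.sum_congr rfl fun x _ => ?_
          by_cases hx : v ∈ leftKernel x <;> simp [hx, hv, W]
    _ ≤ q ^ t * (1 / q) ^ n * ((C / q) ^ t * (q * √(C / q)) ^ n) := by
        rw [← Finset.mul_sum]
        have := sum_prod_norm_fourier_le (h 0)
        gcongr
    _ = C ^ t * √(C / q) ^ n := by
        rw [mul_pow q, div_pow C, one_div_pow]
        field_simp

/-- Comparison of the corank with the limit law by running the chain column by column. -/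
theorem abs_corankExpect_sub_tsum_le (hC : 0 ≤ C) {t : ℕ} :
    ∀ {μ : Fin t → Fin n → F → ℝ} (_ : ∀ j i, IsNearUniformMass C (μ j i)) {f : ℕ → ℝ}
      (_ : ∀ k, f k ∈ Set.Icc 0 1),
    |corankExpect μ f - ∑' k, rectWeight (1 / (Fintype.card F : ℝ)) n t k * f k| ≤
      (1 / (Fintype.card F : ℝ)) ^ n +
        ∑ s ∈ Finset.range t, C ^ s * √(C / Fintype.card F) ^ n := by
  have hq2 : (2 : ℝ) ≤ Fintype.card F := by exact_mod_cast Fintype.one_lt_card (α := F)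
  have h0 : (0 : ℝ) < 1 / Fintype.card F := by positivity
  have h2 : (1 : ℝ) / Fintype.card F ≤ 1 / 2 := by gcongr
  have h1 : (1 : ℝ) / Fintype.card F < 1 := by linarith
  induction t with
  | zero =>
    intro μ h f hf
    have e : corankExpect μ f = f n := by
      have := rank_add_finrank_leftKernel (default : Fin 0 → Fin n → F)
      have h3 := Matrix.rank_le_height (Matrix.of (default : Fin 0 → Fin n → F))
      rw [corankExpect, Fintype.sum_unique, show Module.finrank F
        (leftKernel (default : Fin 0 → Fin n → F)) = n by omega]
      simp [prodMass]
    have e2 : rectWeight (1 / (Fintype.card F : ℝ)) n 0 n =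
        auxWeight (1 / (Fintype.card F : ℝ)) n 0 := by
      simpa using rectWeight_zero_add (1 / (Fintype.card F : ℝ)) n 0
    rw [e, Finset.range_zero, Finset.sum_empty, add_zero]
    -- Without columns the true corank is exactly `n`, so the error is the limit mass off `n`.
    refine (abs_sub_tsum_le (hasSum_rectWeight h0 h1 n 0) (rectWeight_nonneg h0 h1 n 0) hf n).trans ?_
    rw [e2]
    exact one_sub_auxWeight_zero_le h0 h2 n
  | succ t ih =>
    intro μ h f hf
    rw [(hasSum_rectWeight_succ h0 h1 (hasSum_rectWeight h0 h1 n t).summable hf).tsum_eq,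
      Finset.sum_range_succ]
    have a := abs_corankExpect_succ_sub_le hC h hf
    have b := ih (μ := Fin.tail μ) (fun j i => h j.succ i) (chainStep_mem_Icc h0 h1 hf)
    -- The limit side moves by `chainStep` exactly, so the induction hypothesis applies to
    -- `chainStep` of `f` and only one step error is added.
    refine (abs_sub_le _ (corankExpect (Fin.tail μ)
      (chainStep (1 / (Fintype.card F : ℝ)) f)) _).trans ?_
    linarith

open Classical in
/-- Comparison of the corank with the limit law through the probability that the rank is not
full. -/
theorem abs_corankExpect_sub_tsum_le_of_wide (hC : 0 ≤ C) {m : ℕ}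
    {μ : Fin (n + m) → Fin n → F → ℝ} (h : ∀ j i, IsNearUniformMass C (μ j i)) {f : ℕ → ℝ}
    (hf : ∀ k, f k ∈ Set.Icc 0 1) :
    |corankExpect μ f - ∑' k, auxWeight (1 / (Fintype.card F : ℝ)) m k * f k| ≤
      (Fintype.card F : ℝ) ^ n * (C / Fintype.card F) ^ (n + m) +
        (1 / (Fintype.card F : ℝ)) ^ m := by
  have hq2 : (2 : ℝ) ≤ Fintype.card F := by exact_mod_cast Fintype.one_lt_card (α := F)
  have h0 : (0 : ℝ) < 1 / Fintype.card F := by positivity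
  have h2 : (1 : ℝ) / Fintype.card F ≤ 1 / 2 := by gcongr
  have h1 : (1 : ℝ) / Fintype.card F < 1 := by linarith
  have hs := (summable_auxWeight h0 h1 m).hasSum
  rw [tsum_auxWeight h0 h1] at hs
  have b := (abs_sub_tsum_le hs (auxWeight_nonneg h0 h1 m) hf 0).trans
    (one_sub_auxWeight_zero_le h0 h2 m)
  set W := prodMass (fun j => prodMass (μ j))
  have hW : ∀ x, 0 ≤ W x := prodMass_prodMass_nonneg h
  have a : |corankExpect μ f - f 0| ≤ (Fintype.card F : ℝ) ^ n * (C / Fintype.card F) ^ (n + m) := by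
    have e : f 0 = ∑ x, W x * f 0 := by
      rw [← Finset.sum_mul, sum_prodMass_prodMass h, one_mul]
    rw [e, corankExpect, ← Finset.sum_sub_distrib]
    -- Union bound: `f` differs from `f 0` only if the left kernel is nonzero, and then the number
    -- of its nonzero vectors is at least `1`.
    calc _ ≤ ∑ x, W x * ∑ v : Fin n → F, if v ∈ leftKernel x ∧ v ≠ 0 then (1 : ℝ) else 0 := by
          refine (Finset.abs_sum_le_sum_abs _ _).trans (Finset.sum_le_sum fun x _ => ?_)
          rw [← mul_sub, abs_mul]
          refine mul_le_mul (abs_of_nonneg (hW x)).le ?_ (abs_nonneg _) (hW x)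
          have hnn : ∀ v : Fin n → F, (0 : ℝ) ≤ if v ∈ leftKernel x ∧ v ≠ 0 then (1 : ℝ) else 0 :=
            fun v => by split_ifs <;> norm_num
          by_cases hx : leftKernel x = ⊥
          · rw [hx, finrank_bot, sub_self, abs_zero, ← hx]
            exact Finset.sum_nonneg fun v _ => hnn v
          · obtain ⟨v, hv, hv0⟩ := Submodule.exists_mem_ne_zero_of_ne_bot hx
            refine le_trans ?_ (Finset.single_le_sum (fun v _ => hnn v) (Finset.mem_univ v))
            rw [if_pos ⟨hv, hv0⟩]
            have c := hf (Module.finrank F (leftKernel x))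
            exact abs_le.2 ⟨by linarith [c.1, (hf 0).2], by linarith [c.2, (hf 0).1]⟩
      _ = ∑ v : Fin n → F, ∑ x, W x * if v ∈ leftKernel x ∧ v ≠ 0 then (1 : ℝ) else 0 := by
          simp_rw [Finset.mul_sum]
          rw [Finset.sum_comm]
      _ ≤ ∑ _v : Fin n → F, (C / Fintype.card F : ℝ) ^ (n + m) := by
          refine Finset.sum_le_sum fun v _ => ?_
          by_cases hv : v = 0
          · simpa [hv] using (by positivity : 0 ≤ (C / Fintype.card F : ℝ) ^ (n + m))
          · simpa [hv] using sum_mem_leftKernel_le h hv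
      _ = _ := by simp
  exact (abs_sub_le _ (f 0) _).trans (add_le_add a b)

end Chain

/-! ### From random variables to mass functions. -/

section Law

theorem limitLaw_real (q m : ℕ) (hq : 1 < q) (A : Set ℕ) :
    (limitLaw q m hq).toMeasure.real A =
      ∑' k, auxWeight (1 / (q : ℝ)) m k * A.indicator 1 k := by
  have hq' : (1 : ℝ) < q := by exact_mod_cast hq
  have h0 : (0 : ℝ) < 1 / q := by positivity
  have h1 : (1 : ℝ) / q < 1 := (div_lt_one (by positivity)).2 hq'
  rw [Measure.real, PMF.toMeasure_apply _ (MeasurableSet.of_discrete), ENNReal.tsum_toReal_eq]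
  · refine tsum_congr fun k => ?_
    by_cases hk : k ∈ A
    · rw [Set.indicator_of_mem hk, Set.indicator_of_mem hk]
      change (ENNReal.ofReal (limitWeight q m k)).toReal = _
      rw [limitWeight_eq hq, ENNReal.toReal_ofReal (auxWeight_nonneg h0 h1 m k), Pi.one_apply,
        mul_one]
    · simp [hk]
  · intro k
    by_cases hk : k ∈ A
    · rw [Set.indicator_of_mem hk]
      exact ENNReal.ofReal_ne_top
    · simp [hk]

theorem isNearUniformMass_real {F : Type*} [Fintype F] [MeasurableSpace F]
    [DiscreteMeasurableSpace F] {Ω : Type*} [MeasurableSpace Ω] {P : Measure Ω}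
    [IsProbabilityMeasure P] {C : ℝ} {ξ : Ω → F} (hξ : Measurable ξ)
    (h : NearUniform C ξ P) :
    IsNearUniformMass C fun a => P.real {ω | ξ ω = a} where
  nonneg _ := measureReal_nonneg
  sum_eq_one := by
    have := sum_measureReal_preimage_singleton (μ := P) (Finset.univ : Finset F) (f := ξ)
      fun a _ => hξ (measurableSet_singleton a)
    simpa [Set.preimage] using this
  le := h

variable {F : Type*} [Field F] [Fintype F] [MeasurableSpace F] [DiscreteMeasurableSpace F]
  {Ω : Type*} [MeasurableSpace Ω] {P : Measure Ω} [IsProbabilityMeasure P] {n t : ℕ}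

theorem measurable_corank {X : Fin n → Fin t → Ω → F} (hX : ∀ i j, Measurable (X i j)) :
    Measurable fun ω => corank (Matrix.of fun i j => X i j ω) :=
  (measurable_of_countable fun x : Fin n → Fin t → F => corank (Matrix.of x)).comp
    (measurable_pi_lambda _ fun i => measurable_pi_lambda _ fun j => hX i j)

theorem map_corank_real {X : Fin n → Fin t → Ω → F} (hX : ∀ i j, Measurable (X i j))
    (hind : iIndepFun (fun e : Fin n × Fin t => X e.1 e.2) P) (A : Set ℕ) :
    (P.map fun ω => corank (Matrix.of fun i j => X i j ω)).real A =
      corankExpect (fun j i a => P.real {ω | X i j ω = a}) (A.indicator 1) := by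
  classical
  let Z : Ω → Fin t → Fin n → F := fun ω j i => X i j ω
  have hZ : Measurable Z := measurable_pi_lambda _ fun j => measurable_pi_lambda _ fun i => hX i j
  have hfib : ∀ x, P.real (Z ⁻¹' {x}) =
      prodMass (fun j => prodMass fun i a => P.real {ω | X i j ω = a}) x := by
    intro x
    -- Independence of the entries makes the probability of each matrix a product; the indices are
    -- transposed so that columns come first.
    have h := hind.measure_inter_preimage_eq_mul Finset.univ
      (sets := fun e => {x e.2 e.1}) fun e _ => measurableSet_singleton _
    have e : Z ⁻¹' {x} = ⋂ e ∈ (Finset.univ : Finset (Fin n × Fin t)),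
        X e.1 e.2 ⁻¹' {x e.2 e.1} := by
      ext ω
      simp only [Set.mem_preimage, Set.mem_singleton_iff, Set.mem_iInter, Finset.mem_univ,
        true_imp_iff, Prod.forall, funext_iff, Z]
      exact forall_comm
    rw [e, Measure.real, h, ENNReal.toReal_prod, Fintype.prod_prod_type_right]
    rfl
  rw [map_measureReal_apply (measurable_corank hX) MeasurableSet.of_discrete, corankExpect]
  have e : (fun ω => corank (Matrix.of fun i j => X i j ω)) ⁻¹' A =
      Z ⁻¹' ((Finset.univ.filter fun x => Module.finrank F (leftKernel x) ∈ A :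
        Finset (Fin t → Fin n → F)) : Set (Fin t → Fin n → F)) := by
    ext ω
    simp only [Set.mem_preimage, Finset.coe_filter, Finset.mem_univ, true_and]
    rw [corank_of_eq_finrank_leftKernel]
    rfl
  rw [e, ← sum_measureReal_preimage_singleton _ fun x _ => hZ (measurableSet_singleton x),
    Finset.sum_filter]
  refine Finset.sum_congr rfl fun x _ => ?_
  rw [hfib]
  by_cases hx : Module.finrank F (leftKernel x) ∈ A <;> simp [hx]

end Law

/-! ### Numerical bounds for the two regimes. -/

section Bound

theorem two_mul_add_one_le_four_pow (n : ℕ) : (2 * n + 1 : ℝ) ≤ 4 ^ n := by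
  induction n with
  | zero => simp
  | succ n ih =>
    push_cast
    rw [pow_succ]
    linarith [(Nat.cast_nonneg n : (0 : ℝ) ≤ n)]

theorem pow_le_rpow_of_le {b e : ℝ} (h0 : 0 < b) (h1 : b ≤ 1) {k : ℕ} (h : e ≤ k) :
    b ^ k ≤ b ^ e := by
  rw [← Real.rpow_natCast]
  exact Real.rpow_le_rpow_of_exponent_ge h0 h1 h

theorem wide_error_le {C q : ℝ} (hC : 1 ≤ C) (hq : 16 * C ^ 6 ≤ q) {n m : ℕ} (hm : 0 < m)
    (hnm : n ≤ m) :
    q ^ n * (C / q) ^ (n + m) + (1 / q) ^ m ≤ (16 * C ^ 6 / q) ^ (1 / 4 * ((m : ℝ) + n)) := by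
  have hq0 : 0 < q := lt_of_lt_of_le (by positivity) hq
  have hb1 : 16 * C ^ 6 / q ≤ 1 := (div_le_one hq0).2 hq
  refine le_trans ?_ (pow_le_rpow_of_le (k := m) (by positivity) hb1 ?_)
  · have e : q ^ n * (C / q) ^ (n + m) = C ^ (n + m) * (1 / q) ^ m := by
      rw [div_pow, one_div_pow, pow_add q]
      field_simp
    have h1 : C ^ (n + m) ≤ (C ^ 6) ^ m := by
      rw [← pow_mul]
      exact pow_le_pow_right₀ hC (by omega)
    have h2 : 1 ≤ (C ^ 6) ^ m := one_le_pow₀ (one_le_pow₀ hC)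
    have h3 : (2 : ℝ) ≤ 16 ^ m := by
      calc (2 : ℝ) ≤ 16 ^ 1 := by norm_num
        _ ≤ 16 ^ m := pow_le_pow_right₀ (by norm_num) hm
    calc q ^ n * (C / q) ^ (n + m) + (1 / q) ^ m
        = (C ^ (n + m) + 1) * (1 / q) ^ m := by rw [e]; ring
      _ ≤ (16 ^ m * (C ^ 6) ^ m) * (1 / q) ^ m := by
          refine mul_le_mul_of_nonneg_right ?_ (by positivity)
          nlinarith
      _ = (16 * C ^ 6 / q) ^ m := by rw [← mul_pow, ← mul_pow, mul_one_div]
  · have : (n : ℝ) ≤ m := by exact_mod_cast hnm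
    linarith

theorem chain_error_le {C q : ℝ} (hC : 1 ≤ C) (hq : 16 * C ^ 6 ≤ q) {n m : ℕ} (hmn : m ≤ n) :
    (1 / q) ^ n + ∑ s ∈ Finset.range (n + m), C ^ s * √(C / q) ^ n ≤
      (16 * C ^ 6 / q) ^ (1 / 4 * ((m : ℝ) + n)) := by
  have hq0 : 0 < q := lt_of_lt_of_le (by positivity) hq
  have hq1 : 1 ≤ q := by
    have : 1 ≤ C ^ 6 := one_le_pow₀ hC
    linarith
  have hb1 : 16 * C ^ 6 / q ≤ 1 := (div_le_one hq0).2 hq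
  have hs : √(16 * C ^ 6 / q) ≤ 1 := Real.sqrt_le_one.2 hb1
  have hs0 : 0 < √(16 * C ^ 6 / q) := Real.sqrt_pos.2 (by positivity)
  have hD : 0 ≤ √(1 / q) := Real.sqrt_nonneg _
  have e1 : √(16 * C ^ 6 / q) = 4 * C ^ 3 * √(1 / q) := by
    rw [show 16 * C ^ 6 / q = (4 * C ^ 3) ^ 2 * (1 / q) by ring, Real.sqrt_mul (by positivity),
      Real.sqrt_sq (by positivity)]
  have h1 : 1 / q ≤ √(1 / q) := by
    refine Real.le_sqrt_of_sq_le ?_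
    rw [pow_two]
    exact mul_le_of_le_one_left (by positivity) ((div_le_one hq0).2 hq1)
  have h2 : √(C / q) ≤ C * √(1 / q) := by
    rw [Real.sqrt_le_left (by positivity), mul_pow, Real.sq_sqrt (by positivity), mul_one_div]
    gcongr
    nlinarith
  -- Since `m ≤ n`, there are at most `2 * n ≤ 4 ^ n - 1` summands, each with `C ^ s ≤ C ^ (2 * n)`;
  -- another `C ^ n` comes from `√(C / q) ≤ C √(1 / q)`. The resulting base `4 * C ^ 3 * √(1 / q)`
  -- is the square root of `16 * C ^ 6 / q`.
  calc (1 / q) ^ n + ∑ s ∈ Finset.range (n + m), C ^ s * √(C / q) ^ n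
      ≤ √(1 / q) ^ n + ∑ _s ∈ Finset.range (n + m), C ^ (2 * n) * (C * √(1 / q)) ^ n := by
        gcongr with s hsm
        have := Finset.mem_range.1 hsm
        omega
    _ = (1 + (n + m) * (C ^ 3) ^ n) * √(1 / q) ^ n := by
        rw [Finset.sum_const, Finset.card_range, nsmul_eq_mul, mul_pow, ← pow_mul, add_mul,
          show 3 * n = 2 * n + n by ring, pow_add]
        push_cast
        ring
    _ ≤ (4 ^ n * (C ^ 3) ^ n) * √(1 / q) ^ n := by
        refine mul_le_mul_of_nonneg_right ?_ (by positivity)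
        have h3 : 1 ≤ (C ^ 3) ^ n := one_le_pow₀ (one_le_pow₀ hC)
        have h4 : (m : ℝ) ≤ n := by exact_mod_cast hmn
        calc 1 + (n + m) * (C ^ 3) ^ n ≤ (2 * n + 1) * (C ^ 3) ^ n := by nlinarith
          _ ≤ _ := mul_le_mul_of_nonneg_right (two_mul_add_one_le_four_pow n) (by positivity)
    _ = √(16 * C ^ 6 / q) ^ n := by rw [e1, mul_pow, mul_pow]
    _ ≤ (16 * C ^ 6 / q) ^ (1 / 4 * ((m : ℝ) + n)) := by
        rw [Real.sqrt_eq_rpow, ← Real.rpow_mul_natCast (by positivity)]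
        refine Real.rpow_le_rpow_of_exponent_ge (by positivity) hb1 ?_
        have h4 : (m : ℝ) ≤ n := by exact_mod_cast hmn
        linarith

end Bound

end RandomCorank

end

theorem theorem1p4 (C : ℝ) (hC : 1 ≤ C) :
    ∃ c C' : ℝ, 0 < c ∧ 0 < C' ∧
      ∀ (F : Type*) [Field F] [Fintype F] [MeasurableSpace F] [DiscreteMeasurableSpace F]
        (Ω : Type*) [MeasurableSpace Ω] (P : Measure Ω) [IsProbabilityMeasure P]
        (n m : ℕ) (X : Fin n → Fin (n + m) → Ω → F),
        (∀ i j, Measurable (X i j)) →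
        iIndepFun (fun (e : Fin n × Fin (n + m)) => X e.1 e.2) P →
        (∀ i j, RandomCorank.NearUniform C (X i j) P) →
        RandomCorank.tvDist
            (P.map fun ω => RandomCorank.corank (Matrix.of fun i j => X i j ω))
            (RandomCorank.limitLaw (Fintype.card F) m Fintype.one_lt_card).toMeasure
          ≤ (C' / (Fintype.card F : ℝ)) ^ (c * ((m : ℝ) + (n : ℝ))) := by
  -- The chain gives exponent `n / 2 ≥ (m + n) / 4` for `m ≤ n`; the wide case gives exponent `m`,
  -- which is more than enough.
  refine ⟨1 / 4, 16 * C ^ 6, by norm_num, by positivity, ?_⟩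
  intro F _ _ _ _ Ω _ P _ n m X hX hind hnu
  have hq0 := RandomCorank.card_pos_real (F := F)
  have hne : 0 ≤ 1 / 4 * ((m : ℝ) + n) := by positivity
  rw [RandomCorank.tvDist]
  refine ciSup_le fun A => ?_
  let f : ℕ → ℝ := (A : Set ℕ).indicator 1
  have hf : ∀ k, f k ∈ Set.Icc (0 : ℝ) 1 := fun k =>
    ⟨Set.indicator_nonneg (fun _ _ => zero_le_one) k,
      Set.indicator_le_self' (fun _ _ => zero_le_one) k⟩
  have hμ := fun j i => RandomCorank.isNearUniformMass_real (hX i j) (hnu i j)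
  rcases lt_or_ge (Fintype.card F : ℝ) (16 * C ^ 6) with hq | hq
  -- For `q < 16 * C ^ 6` the right side is at least `1`, which bounds any difference of
  -- probabilities.
  · have : IsProbabilityMeasure
        (P.map fun ω => RandomCorank.corank (Matrix.of fun i j => X i j ω)) :=
      Measure.isProbabilityMeasure_map (RandomCorank.measurable_corank hX).aemeasurable
    refine le_trans ?_ (Real.one_le_rpow ((one_le_div hq0).2 hq.le) hne)
    exact abs_le.2 ⟨by linarith [measureReal_nonneg (μ := P.map fun ω =>
        RandomCorank.corank (Matrix.of fun i j => X i j ω)) (s := (A : Set ℕ)),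
        measureReal_le_one (μ := (RandomCorank.limitLaw (Fintype.card F) m
          Fintype.one_lt_card).toMeasure) (s := (A : Set ℕ))],
      by linarith [measureReal_le_one (μ := P.map fun ω =>
        RandomCorank.corank (Matrix.of fun i j => X i j ω)) (s := (A : Set ℕ)),
        measureReal_nonneg (μ := (RandomCorank.limitLaw (Fintype.card F) m
          Fintype.one_lt_card).toMeasure) (s := (A : Set ℕ))]⟩
  rw [RandomCorank.map_corank_real hX hind, RandomCorank.limitLaw_real]
  rcases le_or_gt m n with hmn | hmn
  · refine le_trans ?_ (RandomCorank.chain_error_le hC hq hmn)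
    simpa only [RandomCorank.rectWeight_add] using
      RandomCorank.abs_corankExpect_sub_tsum_le (by linarith) hμ hf
  · exact (RandomCorank.abs_corankExpect_sub_tsum_le_of_wide (by linarith) hμ hf).trans
      (RandomCorank.wide_error_le hC hq (by omega) hmn.le)
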